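/- Notation. A realization of a density operator $\rho$ is a finite family $\{p_i,|\psi_i\rangle\}$ with $p_i\ge 0$, $\sum_i p_i=1$, unit vectors $|\psi_i\rangle$ and $\rho=\sum_i p_i|\psi_i\rangle\langle\psi_i|$. For a two-qubit pure state $|\psi\rangle=\sum a_{ij}|ij\rangle$ let $C(|\psi\rangle)=2|a_{00}a_{11}-a_{01}a_{10}|$; for a two-qubit density operator $\rho$ let $C(\rho)=\min\sum_i p_iC(|\psi_i\rangle)$ (concurrence) and $C_a(\rho)=\max\sum_i p_iC(|\psi_i\rangle)$ (concurrence of assistance), over all realizations of $\rho$. For a three-qubit pure state $|\psi\rangle=\sum a_{ijk}|ijk\rangle$ let $\tau_3(|\psi\rangle)=\sqrt{4|d_1-2d_2+4d_3|}$, where $$d_1=a_{000}^2a_{111}^2+a_{001}^2a_{110}^2+a_{010}^2a_{101}^2+a_{100}^2a_{011}^2,$$ $$d_2=a_{000}a_{111}a_{011}a_{100}+a_{000}a_{111}a_{101}a_{010}+a_{000}a_{111}a_{110}a_{001}+a_{011}a_{100}a_{101}a_{010}+a_{011}a_{100}a_{110}a_{001}+a_{101}a_{010}a_{110}a_{001},$$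 $$d_3=a_{000}a_{110}a_{101}a_{011}+a_{111}a_{001}a_{010}a_{100}.$$ For a three-qubit density operator $\rho$ let $\tau_3(\rho)=\min\sum_ip_i\tau_3(|\psi_i\rangle)$ and $\tau_a(\rho)=\max\sum_ip_i\tau_3(|\psi_i\rangle)$ over all realizations of $\rho$. A realization of $\rho$ is called optimal if it attains $\tau_a(\rho)$. For a unit vector $|\phi\rangle_{ABCD}$ of four qubits let $\rho_{BCD}=\mathrm{Tr}_A|\phi\rangle\langle\phi|$, $\rho_{CD}=\mathrm{Tr}_B\,\rho_{BCD}$, and $\tau_{(A)BCD}=\sqrt{\tau_a^2(\rho_{BCD})-\tau_3^2(\rho_{BCD})}$. For a unit vector $|\psi\rangle_{XCD}$ of a finite-dimensional system $X$ and two qubits $C,D$, the 3-tangle is $\tau_3(|\psi\rangle_{XCD})=\sqrt{C_a^2(\rho_{CD})-C^2(\rho_{CD})}$ with $\rho_{CD}=\mathrm{Tr}_X|\psi\rangle\langle\psi|$; $\tau_3(|\phi\rangle_{[AB]CD})$ is its value with $X=AB$ regarded as a single party. Statement. (0) If $X$ is a qubit, the 3-tangle $\sqrt{C_a^2(\rho_{CD})-C^2(\rho_{CD})}$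 of a unit vector $|\psi\rangle_{XCD}$ coincides with $\tau_3(|\psi\rangle)$ defined by $d_1,d_2,d_3$. (1) For every four-qubit pure state $|\phi\rangle_{ABCD}$, optimal realizations of $\rho_{BCD}$ exist, and for each optimal realization $\{p_i,|\psi_{BCD}\rangle_i\}$, with $\rho^i_{CD}$ the reduction of $|\psi_{BCD}\rangle_i$ to $CD$, $$\tau_{(A)BCD}^2+\tau_3^2(\rho_{BCD})=\Big[\sum_ip_i\sqrt{C_a^2(\rho^i_{CD})-C^2(\rho^i_{CD})}\Big]^2\le C_a^2(\rho_{CD})-C^2(\rho_{CD})=\tau_3^2(|\phi\rangle_{[AB]CD}).$$ (2) The inequality $\tau_{(A)BCD}^2+\tau_3^2(\rho_{BCD})\le\tau_3^2(|\phi\rangle_{[AB]CD})$ is an equality for the four-qubit GHZ state $\frac1{\sqrt2}(|0000\rangle+|1111\rangle)$, which is a unit vector. -/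

import Mathlib

/-!
State vectors of a finite-dimensional system with computational basis `ι` are elements of
`EuclideanSpace ℂ ι`, and its density operators are matrices `Matrix ι ι ℂ`.
A composite system is indexed by a product; the qubits `A, B, C, D` are ordered as
`Fin 2 × Fin 2 × Fin 2 × Fin 2`.
-/

namespace QEnt

noncomputable section

/-- The operator `|ψ⟩⟨ψ|`. -/
def ketBra {ι : Type*} (ψ : EuclideanSpace ℂ ι) : Matrix ι ι ℂ :=
  Matrix.of fun i j => ψ i * star (ψ j)

/-- The partial trace over the first factor. -/
def trFst {α β : Type*} [Fintype α] (ρ : Matrix (α × β) (α × β) ℂ) : Matrix β β ℂ :=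
  Matrix.of fun i j => ∑ a, ρ (a, i) (a, j)

/-- A realization `{p i, |vec i⟩}` of `ρ`: a finite ensemble of normalized pure states whose
mixture is `ρ`. -/
structure Realization {ι : Type*} [Fintype ι] (ρ : Matrix ι ι ℂ) where
  size : ℕ
  p : Fin size → ℝ
  p_nonneg : ∀ i, 0 ≤ p i
  p_sum : ∑ i, p i = 1
  vec : Fin size → EuclideanSpace ℂ ι
  vec_norm : ∀ i, ‖vec i‖ = 1
  mixture : ∑ i, (p i : ℂ) • ketBra (vec i) = ρ

/-- The average `∑ i, p i * f |vec i⟩` of a function of pure states over a realization. -/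
def Realization.average {ι : Type*} [Fintype ι] {ρ : Matrix ι ι ℂ} (e : Realization ρ)
    (f : EuclideanSpace ℂ ι → ℝ) : ℝ :=
  ∑ i, e.p i * f (e.vec i)

/-- The convex roof of `f`: the least average over all realizations. -/
def convexRoof {ι : Type*} [Fintype ι] (f : EuclideanSpace ℂ ι → ℝ) (ρ : Matrix ι ι ℂ) : ℝ :=
  ⨅ e : Realization ρ, e.average f

/-- The quantity of assistance of `f`: the greatest average over all realizations. -/
def assistance {ι : Type*} [Fintype ι] (f : EuclideanSpace ℂ ι → ℝ) (ρ : Matrix ι ι ℂ) : ℝ :=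
  ⨆ e : Realization ρ, e.average f

/-- The concurrence `2 |a₀₀ a₁₁ - a₀₁ a₁₀|` of a two-qubit pure state. -/
def pureConcurrence (ψ : EuclideanSpace ℂ (Fin 2 × Fin 2)) : ℝ :=
  2 * ‖ψ (0, 0) * ψ (1, 1) - ψ (0, 1) * ψ (1, 0)‖

/-- The concurrence `C(ρ)` of a two-qubit state. -/
def concurrence (ρ : Matrix (Fin 2 × Fin 2) (Fin 2 × Fin 2) ℂ) : ℝ :=
  convexRoof pureConcurrence ρ

/-- The concurrence of assistance `C_a(ρ)` of a two-qubit state. -/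
def concurrenceOfAssistance (ρ : Matrix (Fin 2 × Fin 2) (Fin 2 × Fin 2) ℂ) : ℝ :=
  assistance pureConcurrence ρ

/-- The three-tangle `μ₃ = 4 |d₁ - 2 d₂ + 4 d₃|` of a three-qubit pure state. -/
def mu3 (a : EuclideanSpace ℂ (Fin 2 × Fin 2 × Fin 2)) : ℝ :=
  let d1 := a (0, 0, 0) ^ 2 * a (1, 1, 1) ^ 2 + a (0, 0, 1) ^ 2 * a (1, 1, 0) ^ 2
    + a (0, 1, 0) ^ 2 * a (1, 0, 1) ^ 2 + a (1, 0, 0) ^ 2 * a (0, 1, 1) ^ 2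
  let d2 := a (0, 0, 0) * a (1, 1, 1) * a (0, 1, 1) * a (1, 0, 0)
    + a (0, 0, 0) * a (1, 1, 1) * a (1, 0, 1) * a (0, 1, 0)
    + a (0, 0, 0) * a (1, 1, 1) * a (1, 1, 0) * a (0, 0, 1)
    + a (0, 1, 1) * a (1, 0, 0) * a (1, 0, 1) * a (0, 1, 0)
    + a (0, 1, 1) * a (1, 0, 0) * a (1, 1, 0) * a (0, 0, 1)
    + a (1, 0, 1) * a (0, 1, 0) * a (1, 1, 0) * a (0, 0, 1)
  let d3 := a (0, 0, 0) * a (1, 1, 0) * a (1, 0, 1) * a (0, 1, 1)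
    + a (1, 1, 1) * a (0, 0, 1) * a (0, 1, 0) * a (1, 0, 0)
  4 * ‖d1 - 2 * d2 + 4 * d3‖

/-- The 3-tangle `τ₃ = √μ₃` of a three-qubit pure state. -/
def pureTau3 (ψ : EuclideanSpace ℂ (Fin 2 × Fin 2 × Fin 2)) : ℝ :=
  √(mu3 ψ)

/-- The 3-tangle `τ₃(ρ)` of a three-qubit mixed state. -/
def tau3 (ρ : Matrix (Fin 2 × Fin 2 × Fin 2) (Fin 2 × Fin 2 × Fin 2) ℂ) : ℝ :=
  convexRoof pureTau3 ρ

/-- The 3-tangle of assistance `τ_a(ρ)` of a three-qubit mixed state. -/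
def tauA (ρ : Matrix (Fin 2 × Fin 2 × Fin 2) (Fin 2 × Fin 2 × Fin 2) ℂ) : ℝ :=
  assistance pureTau3 ρ

/-- `τ₄[ρ] = √(τ_a(ρ)² - τ₃(ρ)²)` for a three-qubit mixed state `ρ`. -/
def tau4 (ρ : Matrix (Fin 2 × Fin 2 × Fin 2) (Fin 2 × Fin 2 × Fin 2) ℂ) : ℝ :=
  √(tauA ρ ^ 2 - tau3 ρ ^ 2)

/-- `τ_(A)BCD(|φ⟩) = τ₄[Tr_A |φ⟩⟨φ|]` for a four-qubit pure state. -/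
def tauTraceA (φ : EuclideanSpace ℂ (Fin 2 × Fin 2 × Fin 2 × Fin 2)) : ℝ :=
  tau4 (trFst (ketBra φ))

/-- The 3-tangle `√(C_a² - C²)` of a pure state of an `n`-level system and two qubits, where
`C_a` and `C` are those of the reduced state of the two qubits. -/
def pureTau3Gen {ι : Type*} [Fintype ι] (ψ : EuclideanSpace ℂ (ι × Fin 2 × Fin 2)) : ℝ :=
  √(concurrenceOfAssistance (trFst (ketBra ψ)) ^ 2 - concurrence (trFst (ketBra ψ)) ^ 2)

/-- The state `|φ⟩_[AB]CD`: the same vector, with `A` and `B` regarded as one four-level party. -/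
def groupAB (φ : EuclideanSpace ℂ (Fin 2 × Fin 2 × Fin 2 × Fin 2)) :
    EuclideanSpace ℂ ((Fin 2 × Fin 2) × Fin 2 × Fin 2) :=
  WithLp.toLp 2 fun x => φ (x.1.1, x.1.2, x.2)

/-- The state `(|0000⟩ + |1111⟩) / √2`. -/
def ghz4 : EuclideanSpace ℂ (Fin 2 × Fin 2 × Fin 2 × Fin 2) :=
  WithLp.toLp 2 fun x =>
    if x = (0, 0, 0, 0) ∨ x = (1, 1, 1, 1) then ((1 / √2 : ℝ) : ℂ) else 0

end

end QEnt

/-! Let `S` be the symmetric bilinear form with `C(x) = |S(x,x)|`. A reduced state of a three-qubit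
pure state is `|u⟩⟨u| + |v⟩⟨v|`, and a unitary recombination `x, y` of `u, v` with `S(x,y) = 0`
keeps the mixture. With `α = |S(x,x)|` and `β = |S(y,y)|`, triangle inequalities give `C_a = α + β`
and `C = |α - β|`, so `C_a² - C² = 4αβ = 4 |det S|`, which is the hyperdeterminant
(`pureTau3Gen_eq_pureTau3`).

For four qubits, any realization of `ρ_BCD` thus has average 3-tangle `∑ pᵢ √(aᵢ² - cᵢ²)`, where
`aᵢ` and `cᵢ` are the assistance and the concurrence of the reduced states. Cauchy–Schwarz applied
to `(aᵢ - cᵢ)(aᵢ + cᵢ)` bounds its square by `(∑ pᵢ aᵢ)² - (∑ pᵢ cᵢ)²`. Since `C_a` is concave and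
`C` convex under mixing, this is at most `C_a² - C²` of `ρ_CD`. Optimal realizations exist because
the averages form a compact set. -/

namespace QEnt

/-! ### Compactness of convex hulls, and projectors. -/

/-- The convex hull of a compact set in a finite-dimensional space is compact. -/
theorem isCompact_convexHull_of_finiteDimensional {E : Type*} [AddCommGroup E] [Module ℝ E]
    [TopologicalSpace E] [ContinuousAdd E] [ContinuousSMul ℝ E] [FiniteDimensional ℝ E]
    {s : Set E} (hs : IsCompact s) : IsCompact (convexHull ℝ s) := by
  -- Carathéodory: at most `finrank + 1` points suffice, hence the range up to `finrank + 2`. Each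
  -- set in the union is a continuous image of a compact set.
  have key : convexHull ℝ s = ⋃ k ∈ Finset.range (Module.finrank ℝ E + 2),
      (fun q : (Fin k → ℝ) × (Fin k → E) => ∑ i, q.1 i • q.2 i) ''
        (stdSimplex ℝ (Fin k) ×ˢ Set.univ.pi fun _ => s) := by
    apply Set.Subset.antisymm
    · intro x hx
      obtain ⟨ι, _, z, w, hz, hind, hw, hw1, hx⟩ := eq_pos_convex_span_of_mem_convexHull hx
      have hcard : Fintype.card ι ≤ Module.finrank ℝ E + 1 :=
        hind.card_le_finrank_succ.trans (Nat.succ_le_succ (Submodule.finrank_le _))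
      let e := Fintype.equivFin ι
      refine Set.mem_biUnion (x := Fintype.card ι) (by simp; omega)
        ⟨(w ∘ e.symm, z ∘ e.symm), ⟨⟨fun i => (hw _).le, ?_⟩, fun i _ => hz ⟨_, rfl⟩⟩, ?_⟩
      · exact (e.symm.sum_comp w).trans hw1
      · exact (e.symm.sum_comp fun i => w i • z i).trans hx
    · refine Set.iUnion₂_subset fun k _ => ?_
      rintro _ ⟨q, ⟨⟨h0, h1⟩, hq⟩, rfl⟩
      exact mem_convexHull_of_exists_fintype q.1 q.2 h0 h1 (fun i => hq i trivial) rfl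
  rw [key]
  refine (Finset.range _).isCompact_biUnion fun k _ => ?_
  exact ((isCompact_stdSimplex ℝ (Fin k)).prod (isCompact_univ_pi fun _ => hs)).image
    (by fun_prop)

theorem continuous_ketBra {ι : Type*} : Continuous (ketBra : EuclideanSpace ℂ ι → Matrix ι ι ℂ) := by
  unfold ketBra
  refine continuous_matrix fun i j => ?_
  simp only [Matrix.of_apply]
  fun_prop

theorem ketBra_smul {ι : Type*} (c : ℝ) (ψ : EuclideanSpace ℂ ι) :
    ketBra (c • ψ) = ((c ^ 2 : ℝ) : ℂ) • ketBra ψ := by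
  ext i j
  simp [ketBra]
  ring

theorem trace_ketBra {ι : Type*} [Fintype ι] (ψ : EuclideanSpace ℂ ι) :
    (ketBra ψ).trace = ((‖ψ‖ ^ 2 : ℝ) : ℂ) := by
  simp [Matrix.trace, ketBra, EuclideanSpace.norm_sq_eq, Complex.mul_conj']

/-! ### Convex roofs and assistance: attainment and mixing. -/

section Roof

variable {ι : Type*} [Fintype ι] {ρ : Matrix ι ι ℂ} {f : EuclideanSpace ℂ ι → ℝ}

/-- The pairs of a state and the average of `f` over one of its realizations. -/
def averageSet (f : EuclideanSpace ℂ ι → ℝ) : Set (Matrix ι ι ℂ × ℝ) :=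
  convexHull ℝ ((fun ψ => (ketBra ψ, f ψ)) '' Metric.sphere 0 1)

theorem mem_averageSet_of_fintype {κ : Type*} [Fintype κ] (p : κ → ℝ) (hp : ∀ k, 0 ≤ p k)
    (hp1 : ∑ k, p k = 1) (v : κ → EuclideanSpace ℂ ι) (hv : ∀ k, ‖v k‖ = 1) :
    (∑ k, (p k : ℂ) • ketBra (v k), ∑ k, p k * f (v k)) ∈ averageSet f := by
  refine mem_convexHull_of_exists_fintype p (fun k => (ketBra (v k), f (v k))) hp hp1
    (fun k => ⟨v k, by simp [hv], rfl⟩) (Prod.ext ?_ ?_)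
  · simp [Prod.fst_sum]
  · simp [Prod.snd_sum]

theorem mem_averageSet_iff {t : ℝ} :
    (ρ, t) ∈ averageSet f ↔ ∃ e : Realization ρ, e.average f = t := by
  constructor
  · intro h
    obtain ⟨κ, _, p, z, hp, hp1, hz, hx⟩ := mem_convexHull_iff_exists_fintype.1 h
    choose v hv hvz using hz
    let g := Fintype.equivFin κ
    have h1 := congrArg Prod.fst hx
    have h2 := congrArg Prod.snd hx
    simp only [Prod.fst_sum, Prod.snd_sum, Prod.smul_fst, Prod.smul_snd, ← hvz] at h1 h2
    refine ⟨⟨Fintype.card κ, p ∘ g.symm, fun i => hp _, (g.symm.sum_comp p).trans hp1,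
      v ∘ g.symm, fun i => by simpa using hv (g.symm i), ?_⟩, ?_⟩
    · refine (g.symm.sum_comp fun k => (p k : ℂ) • ketBra (v k)).trans ?_
      simpa using h1
    · exact (g.symm.sum_comp fun k => p k * f (v k)).trans (by simpa using h2)
  · rintro ⟨e, rfl⟩
    have := mem_averageSet_of_fintype (f := f) e.p e.p_nonneg e.p_sum e.vec e.vec_norm
    rwa [e.mixture] at this

/-- The averages over realizations of `ρ` are the fibre above `ρ` of a convex hull, compact because
the sphere is. The size of the realizations need not be bounded beforehand. -/
theorem isCompact_averages (hf : Continuous f) :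
    IsCompact (Set.range fun e : Realization ρ => e.average f) := by
  have hs : IsCompact (averageSet f) :=
    isCompact_convexHull_of_finiteDimensional
      ((isCompact_sphere 0 1).image (continuous_ketBra.prodMk hf))
  have : (Set.range fun e : Realization ρ => e.average f)
      = Prod.snd '' (averageSet f ∩ Prod.fst ⁻¹' {ρ}) := by
    ext t
    simp only [Set.mem_range, ← mem_averageSet_iff, Set.mem_image]
    constructor
    · exact fun h => ⟨(ρ, t), ⟨h, rfl⟩, rfl⟩
    · rintro ⟨⟨σ, t'⟩, ⟨h, rfl⟩, rfl⟩
      exact h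
  rw [this]
  exact (hs.inter_right (isClosed_singleton.preimage continuous_fst)).image continuous_snd

theorem Realization.average_le_assistance (hf : Continuous f) (e : Realization ρ) :
    e.average f ≤ assistance f ρ :=
  le_ciSup (f := fun e : Realization ρ => e.average f) (isCompact_averages hf).bddAbove e

theorem Realization.convexRoof_le_average (hf : Continuous f) (e : Realization ρ) :
    convexRoof f ρ ≤ e.average f :=
  ciInf_le (f := fun e : Realization ρ => e.average f) (isCompact_averages hf).bddBelow e

theorem exists_average_eq_assistance (hf : Continuous f) [Nonempty (Realization ρ)] :
    ∃ e : Realization ρ, e.average f = assistance f ρ :=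
  (isCompact_averages hf).sSup_mem (Set.range_nonempty _)

theorem exists_average_eq_convexRoof (hf : Continuous f) [Nonempty (Realization ρ)] :
    ∃ e : Realization ρ, e.average f = convexRoof f ρ :=
  (isCompact_averages hf).sInf_mem (Set.range_nonempty _)

theorem Realization.average_nonneg (hf : ∀ ψ, 0 ≤ f ψ) (e : Realization ρ) : 0 ≤ e.average f :=
  Finset.sum_nonneg fun i _ => mul_nonneg (e.p_nonneg i) (hf _)

theorem convexRoof_nonneg (hf : ∀ ψ, 0 ≤ f ψ) : 0 ≤ convexRoof f ρ :=
  Real.iInf_nonneg fun e => e.average_nonneg hf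

theorem convexRoof_le_assistance (hf : Continuous f) [Nonempty (Realization ρ)] :
    convexRoof f ρ ≤ assistance f ρ :=
  let ⟨e, he⟩ := exists_average_eq_assistance (ρ := ρ) hf
  he ▸ e.convexRoof_le_average hf

/-- Merging realizations of the `σ i` is convexity of `averageSet`. It makes assistance concave and
the convex roof convex under mixing. -/
theorem exists_realization_mixture {n : ℕ} {p : Fin n → ℝ} (hp : ∀ i, 0 ≤ p i)
    (hp1 : ∑ i, p i = 1) {σ : Fin n → Matrix ι ι ℂ} (hρ : ∑ i, (p i : ℂ) • σ i = ρ)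
    (e : ∀ i, Realization (σ i)) :
    ∃ e' : Realization ρ, e'.average f = ∑ i, p i * (e i).average f := by
  rw [← mem_averageSet_iff]
  have : ∑ i, p i • (σ i, (e i).average f) ∈ averageSet f := (convex_convexHull ℝ _).sum_mem (t := Finset.univ) (fun i _ => hp i) hp1
    (fun i _ => (mem_averageSet_iff (f := f)).2 ⟨e i, rfl⟩)
  convert this using 1
  refine Prod.ext ?_ ?_
  · simp [Prod.fst_sum, ← hρ]
  · simp [Prod.snd_sum]

theorem le_assistance_mixture (hf : Continuous f) {n : ℕ} {p : Fin n → ℝ} (hp : ∀ i, 0 ≤ p i)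
    (hp1 : ∑ i, p i = 1) {σ : Fin n → Matrix ι ι ℂ} (hρ : ∑ i, (p i : ℂ) • σ i = ρ)
    [∀ i, Nonempty (Realization (σ i))] :
    ∑ i, p i * assistance f (σ i) ≤ assistance f ρ := by
  choose e he using fun i => exists_average_eq_assistance (ρ := σ i) hf
  obtain ⟨e', h⟩ := exists_realization_mixture (f := f) hp hp1 hρ e
  simp only [he] at h
  exact h ▸ e'.average_le_assistance hf

theorem convexRoof_mixture_le (hf : Continuous f) {n : ℕ} {p : Fin n → ℝ} (hp : ∀ i, 0 ≤ p i)
    (hp1 : ∑ i, p i = 1) {σ : Fin n → Matrix ι ι ℂ} (hρ : ∑ i, (p i : ℂ) • σ i = ρ)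
    [∀ i, Nonempty (Realization (σ i))] :
    convexRoof f ρ ≤ ∑ i, p i * convexRoof f (σ i) := by
  choose e he using fun i => exists_average_eq_convexRoof (ρ := σ i) hf
  obtain ⟨e', h⟩ := exists_realization_mixture (f := f) hp hp1 hρ e
  simp only [he] at h
  exact h ▸ e'.convexRoof_le_average hf

/-- A family of vectors with squared norms of sum one, not necessarily normalized, yields a
realization. -/
theorem exists_realization_of_sum_norm_sq {κ : Type*} [Fintype κ] (w : κ → EuclideanSpace ℂ ι)
    (hw : ∑ k, ‖w k‖ ^ 2 = 1) (hρ : ∑ k, ketBra (w k) = ρ)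
    (hf : ∀ (c : ℝ) ψ, f (c • ψ) = c ^ 2 * f ψ) :
    ∃ e : Realization ρ, e.average f = ∑ k, f (w k) := by
  obtain ⟨k₀, hk₀⟩ : ∃ k, w k ≠ 0 := by
    by_contra! h
    simp [h] at hw
  -- A zero vector gets weight `0`, but still needs some unit vector in its place.
  let v : κ → EuclideanSpace ℂ ι := fun k =>
    if w k = 0 then ‖w k₀‖⁻¹ • w k₀ else ‖w k‖⁻¹ • w k
  have hv : ∀ k, ‖v k‖ = 1 := by
    intro k
    by_cases h : w k = 0
    · simp [v, h, norm_smul, hk₀]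
    · simp [v, h, norm_smul]
  have hvw : ∀ k, w k = ‖w k‖ • v k := by
    intro k
    by_cases h : w k = 0
    · simp [h]
    · simp [v, h, smul_smul]
  rw [← mem_averageSet_iff]
  convert mem_averageSet_of_fintype (f := f) (fun k => ‖w k‖ ^ 2) (fun k => by positivity) hw v hv
    using 2
  · rw [← hρ]
    exact Finset.sum_congr rfl fun k _ => by
      conv_lhs => rw [hvw k, ketBra_smul]
  · exact Finset.sum_congr rfl fun k _ => by
      conv_lhs => rw [hvw k, hf]

end Roof

/-! ### Balanced recombination of two vectors. -/

section BalancedPair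

variable {ι : Type*}

/-- The balanced recombinations `(x ± y) / √2` of two vectors. -/
noncomputable def balancedPair (x y : EuclideanSpace ℂ ι) : Fin 2 → EuclideanSpace ℂ ι :=
  ![(√2)⁻¹ • (x + y), (√2)⁻¹ • (x - y)]

theorem ofReal_inv_sqrt_two_mul_self : ((√2 : ℝ) : ℂ)⁻¹ * ((√2 : ℝ) : ℂ)⁻¹ = 1 / 2 := by
  rw [← mul_inv, ← Complex.ofReal_mul, Real.mul_self_sqrt (by norm_num)]
  norm_num

theorem sum_ketBra_balancedPair (x y : EuclideanSpace ℂ ι) :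
    ∑ k, ketBra (balancedPair x y k) = ketBra x + ketBra y := by
  ext i j
  simp [balancedPair, ketBra, Fin.sum_univ_two]
  linear_combination (2 * (x i * (starRingEnd ℂ) (x j) + y i * (starRingEnd ℂ) (y j)))
    * ofReal_inv_sqrt_two_mul_self

theorem sum_norm_sq_balancedPair [Fintype ι] (x y : EuclideanSpace ℂ ι) :
    ∑ k, ‖balancedPair x y k‖ ^ 2 = ‖x‖ ^ 2 + ‖y‖ ^ 2 := by
  have h := congrArg Matrix.trace (sum_ketBra_balancedPair x y)
  rw [Matrix.trace_sum, Matrix.trace_add] at h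
  simp only [trace_ketBra] at h
  exact_mod_cast h

theorem ketBra_smul_of_norm_eq_one {c : ℂ} (hc : ‖c‖ = 1) (x : EuclideanSpace ℂ ι) :
    ketBra (c • x) = ketBra x := by
  have h : c * (starRingEnd ℂ) c = 1 := by
    rw [Complex.mul_conj', hc]
    norm_num
  ext i j
  simp [ketBra]
  linear_combination (x i * (starRingEnd ℂ) (x j)) * h

end BalancedPair

/-! ### Partial trace and slices. -/

section PartialTrace

variable {α β : Type*} [Fintype α]

/-- The component `⟨a|ψ⟩` of a vector of a bipartite system. -/
def slice (ψ : EuclideanSpace ℂ (α × β)) (a : α) : EuclideanSpace ℂ β :=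
  WithLp.toLp 2 fun b => ψ (a, b)

theorem trFst_ketBra (ψ : EuclideanSpace ℂ (α × β)) :
    ∑ a, ketBra (slice ψ a) = trFst (ketBra ψ) := by
  ext i j
  simp [trFst, ketBra, slice, Matrix.sum_apply]

theorem sum_norm_slice_sq [Fintype β] (ψ : EuclideanSpace ℂ (α × β)) : ∑ a, ‖slice ψ a‖ ^ 2 = ‖ψ‖ ^ 2 := by
  simp [EuclideanSpace.norm_sq_eq, slice, Fintype.sum_prod_type]

theorem nonempty_realization_trFst [Fintype β] {ψ : EuclideanSpace ℂ (α × β)} (hψ : ‖ψ‖ = 1) :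
    Nonempty (Realization (trFst (ketBra ψ))) :=
  let ⟨e, _⟩ := exists_realization_of_sum_norm_sq (f := fun _ => 0) (slice ψ)
    (by rw [sum_norm_slice_sq, hψ, one_pow]) (trFst_ketBra ψ) (by simp)
  ⟨e⟩

theorem trFst_sum_smul {n : ℕ} (c : Fin n → ℂ) (σ : Fin n → Matrix (α × β) (α × β) ℂ) :
    trFst (∑ i, c i • σ i) = ∑ i, c i • trFst (σ i) := by
  ext x y
  simp only [trFst, Matrix.of_apply, Matrix.sum_apply, Matrix.smul_apply, Finset.smul_sum]
  exact Finset.sum_comm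

end PartialTrace

/-! ### Coneigenvectors, phases, and the form `S`. -/

open scoped ComplexOrder in
/-- Every complex symmetric `2 × 2` matrix with
entries `a, b, d` has a unit coneigenvector `(c, s)`. -/
theorem exists_coneigenvector (a b d : ℂ) :
    ∃ (c s : ℂ) (l : ℝ), ‖c‖ ^ 2 + ‖s‖ ^ 2 = 1 ∧
      a * c + b * s = l * star c ∧ b * c + d * s = l * star s := by
  suffices h : ∃ (c s : ℂ) (l : ℝ), ¬ (c = 0 ∧ s = 0) ∧
      a * c + b * s = l * star c ∧ b * c + d * s = l * star s by
    obtain ⟨c, s, l, hne, h1, h2⟩ := h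
    have hpos : 0 < ‖c‖ ^ 2 + ‖s‖ ^ 2 := by
      by_contra! h
      have hc := sq_nonneg ‖c‖
      have hs := sq_nonneg ‖s‖
      exact hne ⟨by simpa using (by linarith : ‖c‖ ^ 2 = 0), by simpa using (by linarith : ‖s‖ ^ 2 = 0)⟩
    set r := (√(‖c‖ ^ 2 + ‖s‖ ^ 2))⁻¹ with hr
    have hr2 : r ^ 2 = (‖c‖ ^ 2 + ‖s‖ ^ 2)⁻¹ := by
      rw [hr, inv_pow, Real.sq_sqrt hpos.le]
    refine ⟨r * c, r * s, l, ?_, ?_, ?_⟩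
    · simp only [norm_mul, mul_pow, Complex.norm_real, Real.norm_eq_abs, sq_abs]
      rw [← mul_add, hr2, inv_mul_cancel₀ hpos.ne']
    · simp only [star_mul', RCLike.star_def, Complex.conj_ofReal] at h1 ⊢
      linear_combination (r : ℂ) * h1
    · simp only [star_mul', RCLike.star_def, Complex.conj_ofReal] at h2 ⊢
      linear_combination (r : ℂ) * h2
  let T : Matrix (Fin 2) (Fin 2) ℂ := !![a, b; b, d]
  -- Take `Tᴴ T x = l² x`. As `T` is symmetric, `z = conj (T x) + l x` satisfies `T z = l conj z`.
  -- If `z = 0`, then `T x = -l conj x`, and `i x` is a coneigenvector for `l`.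
  have hM := Matrix.posSemidef_conjTranspose_mul_self T
  set x := hM.1.eigenvectorBasis 0 with hx
  have hx0 : ¬ (x 0 = 0 ∧ x 1 = 0) := by
    rintro ⟨h0, h1⟩
    refine hM.1.eigenvectorBasis.orthonormal.ne_zero 0 ?_
    ext i
    fin_cases i
    · exact h0
    · exact h1
  have heig := hM.1.mulVec_eigenvectorBasis 0
  have hμ := hM.eigenvalues_nonneg 0
  rw [← hx] at heig
  set μ := hM.1.eigenvalues 0
  set l := √μ with hl
  have hl2 : ((l : ℂ)) * l = μ := by
    rw [← Complex.ofReal_mul, Real.mul_self_sqrt hμ]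
  have e0 := congrFun heig 0
  have e1 := congrFun heig 1
  simp [T, Matrix.mulVec, dotProduct, Matrix.mul_apply, Fin.sum_univ_two] at e0 e1
  by_cases hz : star (a * x 0 + b * x 1) + l * x 0 = 0 ∧ star (b * x 0 + d * x 1) + l * x 1 = 0
  · obtain ⟨z0, z1⟩ := hz
    have z0' := congrArg star z0
    have z1' := congrArg star z1
    simp at z0' z1'
    refine ⟨Complex.I * x 0, Complex.I * x 1, l, by simpa using hx0, ?_, ?_⟩
    · simp
      linear_combination Complex.I * z0'
    · simp
      linear_combination Complex.I * z1'
  · refine ⟨_, _, l, hz, ?_, ?_⟩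
    · have := congrArg star e0
      simp at this ⊢
      simp only [← RCLike.star_def] at this ⊢
      linear_combination this - star (x 0) * hl2
    · have := congrArg star e1
      simp at this ⊢
      simp only [← RCLike.star_def] at this ⊢
      linear_combination this - star (x 1) * hl2

/-- The phase is chosen so that `ω² β` points opposite to `α`. It enters squared because it
multiplies a vector inside a quadratic form. -/
theorem exists_phase (α β : ℂ) :
    ∃ ω : ℂ, ‖ω‖ = 1 ∧ ‖α + ω ^ 2 * β‖ = |‖α‖ - ‖β‖| := by
  refine ⟨Complex.I * Complex.exp (((α.arg - β.arg) / 2 : ℝ) * Complex.I), ?_, ?_⟩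
  · rw [norm_mul, Complex.norm_exp_ofReal_mul_I, Complex.norm_I, one_mul]
  · have h : α + (Complex.I * Complex.exp (((α.arg - β.arg) / 2 : ℝ) * Complex.I)) ^ 2 * β
        = ((‖α‖ - ‖β‖ : ℝ) : ℂ) * Complex.exp (α.arg * Complex.I) := by
      have hα := Complex.norm_mul_exp_arg_mul_I α
      have hβ := Complex.norm_mul_exp_arg_mul_I β
      rw [mul_pow, Complex.I_sq, ← Complex.exp_nat_mul]
      have : Complex.exp (α.arg * Complex.I) =
          Complex.exp ((2 : ℕ) * (((α.arg - β.arg) / 2 : ℝ) * Complex.I))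
            * Complex.exp (β.arg * Complex.I) := by
        rw [← Complex.exp_add]
        congr 1
        push_cast
        ring
      push_cast at this ⊢
      linear_combination (‖β‖ : ℂ) * this - hα
        + Complex.exp (2 * ((α.arg - β.arg) / 2 * Complex.I)) * hβ
    rw [h, norm_mul, Complex.norm_exp_ofReal_mul_I, mul_one, Complex.norm_real, Real.norm_eq_abs]

/-- A linear functional has the same mean square modulus over two ensembles with one mixture. -/
theorem sum_norm_sq_eq_of_sum_ketBra_eq {ι κ κ' : Type*} [Fintype ι] [Fintype κ] [Fintype κ']
    {p : κ → ℝ} {v : κ → EuclideanSpace ℂ ι} {w : κ' → EuclideanSpace ℂ ι}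
    (h : ∑ k, (p k : ℂ) • ketBra (v k) = ∑ k, ketBra (w k))
    (g : EuclideanSpace ℂ ι →ₗ[ℂ] ℂ) :
    ∑ k, p k * ‖g (v k)‖ ^ 2 = ∑ k, ‖g (w k)‖ ^ 2 := by
  classical
  let F : Matrix ι ι ℂ →ₗ[ℂ] ℂ :=
    ∑ i, ∑ j, (g (EuclideanSpace.single i 1) * star (g (EuclideanSpace.single j 1))) •
      Matrix.entryLinearMap ℂ ℂ i j
  have hg : ∀ x : EuclideanSpace ℂ ι, g x = ∑ i, g (EuclideanSpace.single i 1) * x i := by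
    intro x
    conv_lhs => rw [← (EuclideanSpace.basisFun ι ℂ).sum_repr x]
    simp [map_sum, mul_comm]
  have hF : ∀ x, F (ketBra x) = ((‖g x‖ ^ 2 : ℝ) : ℂ) := by
    intro x
    rw [Complex.ofReal_pow, ← Complex.mul_conj', hg x, map_sum, Finset.sum_mul_sum]
    simp only [F, LinearMap.sum_apply, LinearMap.smul_apply, Matrix.entryLinearMap_apply, ketBra,
      Matrix.of_apply, smul_eq_mul, map_mul, RCLike.star_def]
    exact Finset.sum_congr rfl fun i _ => Finset.sum_congr rfl fun j _ => by ring
  have := congrArg F h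
  simp only [map_sum, map_smul, hF, smul_eq_mul] at this
  exact_mod_cast this

/-- The symmetric bilinear form whose quadratic form has the concurrence as its modulus. -/
def spinFlip (x y : EuclideanSpace ℂ (Fin 2 × Fin 2)) : ℂ :=
  x (0, 0) * y (1, 1) + x (1, 1) * y (0, 0) - x (0, 1) * y (1, 0) - x (1, 0) * y (0, 1)

theorem pureConcurrence_eq (x : EuclideanSpace ℂ (Fin 2 × Fin 2)) :
    pureConcurrence x = ‖spinFlip x x‖ := by
  have : spinFlip x x = 2 * (x (0, 0) * x (1, 1) - x (0, 1) * x (1, 0)) := by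
    unfold spinFlip
    ring
  rw [this, norm_mul, Complex.norm_ofNat, pureConcurrence]

theorem continuous_pureConcurrence : Continuous pureConcurrence := by
  unfold pureConcurrence
  fun_prop

theorem pureConcurrence_nonneg (x : EuclideanSpace ℂ (Fin 2 × Fin 2)) :
    0 ≤ pureConcurrence x := by
  unfold pureConcurrence
  positivity

theorem pureConcurrence_smul (c : ℝ) (x : EuclideanSpace ℂ (Fin 2 × Fin 2)) :
    pureConcurrence (c • x) = c ^ 2 * pureConcurrence x := by
  have : spinFlip (c • x) (c • x) = (c : ℂ) ^ 2 * spinFlip x x := by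
    simp [spinFlip]
    ring
  rw [pureConcurrence_eq, this, pureConcurrence_eq, norm_mul, norm_pow, Complex.norm_real,
    Real.norm_eq_abs, sq_abs]

/-- The three-tangle in terms of the two components of the first qubit. -/
theorem mu3_eq (ψ : EuclideanSpace ℂ (Fin 2 × Fin 2 × Fin 2)) :
    mu3 ψ = 4 * ‖spinFlip (slice ψ 0) (slice ψ 0) * spinFlip (slice ψ 1) (slice ψ 1)
      - spinFlip (slice ψ 0) (slice ψ 1) ^ 2‖ := by
  simp only [mu3, spinFlip, slice]
  -- The determinant of `S` on the slices is `-(d₁ - 2 d₂ + 4 d₃)`.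
  rw [← norm_neg]
  congr 2
  ring

theorem continuous_pureTau3 : Continuous pureTau3 := by
  unfold pureTau3 mu3
  fun_prop

theorem pureTau3_nonneg (ψ : EuclideanSpace ℂ (Fin 2 × Fin 2 × Fin 2)) : 0 ≤ pureTau3 ψ :=
  Real.sqrt_nonneg _

theorem pureTau3_smul (c : ℝ) (ψ : EuclideanSpace ℂ (Fin 2 × Fin 2 × Fin 2)) :
    pureTau3 (c • ψ) = c ^ 2 * pureTau3 ψ := by
  have : mu3 (c • ψ) = (c ^ 2) ^ 2 * mu3 ψ := by
    have h : ∀ a b, spinFlip (slice (c • ψ) a) (slice (c • ψ) b)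
        = (c : ℂ) ^ 2 * spinFlip (slice ψ a) (slice ψ b) := by
      intro a b
      simp [spinFlip, slice]
      ring
    have hc : ((c ^ 2) ^ 2 : ℝ) = ‖((c : ℂ) ^ 2) ^ 2‖ := by simp
    rw [mu3_eq, mu3_eq, hc, mul_left_comm, ← norm_mul]
    simp only [h]
    ring_nf
  rw [pureTau3, this, Real.sqrt_mul (by positivity), Real.sqrt_sq (by positivity), pureTau3]

/-! ### Concurrence and assistance of a mixture of two `S`-orthogonal vectors. -/

section RankTwo

variable {v₀ v₁ : EuclideanSpace ℂ (Fin 2 × Fin 2)}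
  {ρ : Matrix (Fin 2 × Fin 2) (Fin 2 × Fin 2) ℂ}

/-- Each vector of positive weight is a combination of `v₀, v₁`, and `S`-orthogonality leaves only
the two square terms in its concurrence. The coefficients are read off by the functionals `S(vⱼ,
·)`, whose mean squares depend only on `ρ`. -/
theorem exists_weights (hS : spinFlip v₀ v₁ = 0) (hρ : ketBra v₀ + ketBra v₁ = ρ)
    (e : Realization ρ) :
    ∃ k₀ k₁ : Fin e.size → ℂ,
      (∀ i, e.p i * pureConcurrence (e.vec i)
        = e.p i * ‖k₀ i ^ 2 * spinFlip v₀ v₀ + k₁ i ^ 2 * spinFlip v₁ v₁‖) ∧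
      ∑ i, e.p i * (‖k₀ i‖ ^ 2 * ‖spinFlip v₀ v₀‖) = ‖spinFlip v₀ v₀‖ ∧
      ∑ i, e.p i * (‖k₁ i‖ ^ 2 * ‖spinFlip v₁ v₁‖) = ‖spinFlip v₁ v₁‖ := by
  have hsym : spinFlip v₁ v₀ = 0 := by
    rw [← hS]
    unfold spinFlip
    ring
  have hmean : ∀ g : EuclideanSpace ℂ (Fin 2 × Fin 2) →ₗ[ℂ] ℂ,
      ∑ i, e.p i * ‖g (e.vec i)‖ ^ 2 = ‖g v₀‖ ^ 2 + ‖g v₁‖ ^ 2 := by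
    intro g
    rw [sum_norm_sq_eq_of_sum_ketBra_eq (w := ![v₀, v₁]) (e.mixture.trans (by simp [hρ])) g]
    simp
  have hweight : ∀ u, spinFlip u v₀ = 0 ∧ u = v₁ ∨ spinFlip u v₁ = 0 ∧ u = v₀ →
      ∑ i, e.p i * (‖spinFlip u (e.vec i) / spinFlip u u‖ ^ 2 * ‖spinFlip u u‖)
        = ‖spinFlip u u‖ := by
    intro u hu
    let g : EuclideanSpace ℂ (Fin 2 × Fin 2) →ₗ[ℂ] ℂ :=
      { toFun := spinFlip u
        map_add' := fun x y => by simp [spinFlip]; ring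
        map_smul' := fun c x => by simp [spinFlip]; ring }
    have hg : ∑ i, e.p i * ‖spinFlip u (e.vec i)‖ ^ 2 = ‖spinFlip u u‖ ^ 2 := by
      refine (hmean g).trans ?_
      change ‖spinFlip u v₀‖ ^ 2 + ‖spinFlip u v₁‖ ^ 2 = _
      rcases hu with ⟨h, rfl⟩ | ⟨h, rfl⟩ <;> simp [h]
    by_cases h0 : ‖spinFlip u u‖ = 0
    · simp [h0]
    · calc _ = (∑ i, e.p i * ‖spinFlip u (e.vec i)‖ ^ 2) / ‖spinFlip u u‖ := by
            rw [Finset.sum_div]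
            refine Finset.sum_congr rfl fun i _ => ?_
            rw [norm_div]
            field_simp
        _ = _ := by rw [hg]; field_simp
  -- If `S(vⱼ, vⱼ) = 0`, the quotient is `0` by convention; this is harmless, as the coefficient
  -- only ever multiplies `S(vⱼ, vⱼ)`.
  refine ⟨fun i => spinFlip v₀ (e.vec i) / spinFlip v₀ v₀,
    fun i => spinFlip v₁ (e.vec i) / spinFlip v₁ v₁, fun i => ?_,
    hweight v₀ (.inr ⟨hS, rfl⟩), hweight v₁ (.inl ⟨hsym, rfl⟩)⟩
  by_cases hp : e.p i = 0
  · simp [hp]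
  congr 1
  -- A functional vanishing on `v₀` and `v₁` has mean square zero over the realization, so it
  -- vanishes on every vector of positive weight.
  have hmem : e.vec i ∈ Submodule.span ℂ {v₀, v₁} := by
    by_contra hnot
    obtain ⟨g, hg, hle⟩ := Submodule.exists_le_ker_of_notMem hnot
    have h0 : g v₀ = 0 := hle (Submodule.subset_span (by simp))
    have h1 : g v₁ = 0 := hle (Submodule.subset_span (by simp))
    have h := hmean g
    simp only [h0, h1, norm_zero, ne_eq, OfNat.ofNat_ne_zero, not_false_eq_true, zero_pow,
      add_zero] at h
    have := (Finset.sum_eq_zero_iff_of_nonneg fun j _ =>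
      mul_nonneg (e.p_nonneg j) (sq_nonneg ‖g (e.vec j)‖)).1 h i (Finset.mem_univ i)
    simp [hp, hg] at this
  obtain ⟨x, y, hxy⟩ := Submodule.mem_span_pair.1 hmem
  have h0 : spinFlip v₀ (e.vec i) = x * spinFlip v₀ v₀ + y * spinFlip v₀ v₁ := by
    rw [← hxy]; simp [spinFlip]; ring
  have h1 : spinFlip v₁ (e.vec i) = x * spinFlip v₁ v₀ + y * spinFlip v₁ v₁ := by
    rw [← hxy]; simp [spinFlip]; ring
  have h2 : spinFlip (e.vec i) (e.vec i) = x ^ 2 * spinFlip v₀ v₀ + 2 * x * y * spinFlip v₀ v₁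
      + y ^ 2 * spinFlip v₁ v₁ := by
    rw [← hxy]; simp [spinFlip]; ring
  simp only [pureConcurrence_eq, h0, h1, h2, hS, hsym]
  congr 1
  by_cases ha : spinFlip v₀ v₀ = 0 <;> by_cases hb : spinFlip v₁ v₁ = 0 <;> simp [ha, hb]

theorem Realization.average_pureConcurrence_le (hS : spinFlip v₀ v₁ = 0)
    (hρ : ketBra v₀ + ketBra v₁ = ρ) (e : Realization ρ) :
    e.average pureConcurrence ≤ ‖spinFlip v₀ v₀‖ + ‖spinFlip v₁ v₁‖ := by
  obtain ⟨k₀, k₁, h, h0, h1⟩ := exists_weights hS hρ e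
  conv_rhs => rw [← h0, ← h1, ← Finset.sum_add_distrib]
  refine Finset.sum_le_sum fun i _ => ?_
  rw [h, ← mul_add, ← norm_pow, ← norm_pow, ← norm_mul, ← norm_mul]
  exact mul_le_mul_of_nonneg_left (norm_add_le _ _) (e.p_nonneg i)

theorem Realization.le_average_pureConcurrence (hS : spinFlip v₀ v₁ = 0)
    (hρ : ketBra v₀ + ketBra v₁ = ρ) (e : Realization ρ) :
    |‖spinFlip v₀ v₀‖ - ‖spinFlip v₁ v₁‖| ≤ e.average pureConcurrence := by
  obtain ⟨k₀, k₁, h, h0, h1⟩ := exists_weights hS hρ e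
  conv_lhs => rw [← h0, ← h1, ← Finset.sum_sub_distrib]
  refine (Finset.abs_sum_le_sum_abs _ _).trans (Finset.sum_le_sum fun i _ => ?_)
  rw [h, ← mul_sub, abs_mul, abs_of_nonneg (e.p_nonneg i), ← norm_pow, ← norm_pow, ← norm_mul,
    ← norm_mul]
  refine mul_le_mul_of_nonneg_left ?_ (e.p_nonneg i)
  have := abs_norm_sub_norm_le (k₀ i ^ 2 * spinFlip v₀ v₀) (-(k₁ i ^ 2 * spinFlip v₁ v₁))
  rwa [norm_neg, sub_neg_eq_add] at this

theorem concurrenceOfAssistance_eq (hS : spinFlip v₀ v₁ = 0) (hρ : ketBra v₀ + ketBra v₁ = ρ)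
    (hn : ‖v₀‖ ^ 2 + ‖v₁‖ ^ 2 = 1) :
    concurrenceOfAssistance ρ = ‖spinFlip v₀ v₀‖ + ‖spinFlip v₁ v₁‖ := by
  obtain ⟨e, he⟩ := exists_realization_of_sum_norm_sq (ρ := ρ) ![v₀, v₁] (by simpa using hn)
    (by simpa using hρ) pureConcurrence_smul
  simp only [Fin.sum_univ_two, Matrix.cons_val_zero, Matrix.cons_val_one, pureConcurrence_eq] at he
  have : Nonempty (Realization ρ) := ⟨e⟩
  exact le_antisymm (ciSup_le fun e => e.average_pureConcurrence_le hS hρ)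
    (he ▸ e.average_le_assistance continuous_pureConcurrence)

theorem concurrence_eq (hS : spinFlip v₀ v₁ = 0) (hρ : ketBra v₀ + ketBra v₁ = ρ)
    (hn : ‖v₀‖ ^ 2 + ‖v₁‖ ^ 2 = 1) :
    concurrence ρ = |‖spinFlip v₀ v₀‖ - ‖spinFlip v₁ v₁‖| := by
  -- The vectors `(v₀ ± ω v₁)/√2` have equal values of `S`, since the cross terms vanish; each
  -- contributes half of the minimum.
  obtain ⟨ω, hω, hω2⟩ := exists_phase (spinFlip v₀ v₀) (spinFlip v₁ v₁)
  set w := balancedPair v₀ (ω • v₁) with hw_def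
  have hwρ : ∑ k, ketBra (w k) = ρ := by
    rw [sum_ketBra_balancedPair, ketBra_smul_of_norm_eq_one hω, hρ]
  have hwn : ∑ k, ‖w k‖ ^ 2 = 1 := by
    rw [sum_norm_sq_balancedPair, norm_smul, hω, one_mul, hn]
  obtain ⟨e, he⟩ := exists_realization_of_sum_norm_sq (ρ := ρ) w hwn hwρ pureConcurrence_smul
  have hw : ∀ k, pureConcurrence (w k) = 1 / 2 * |‖spinFlip v₀ v₀‖ - ‖spinFlip v₁ v₁‖| := by
    intro k
    have : spinFlip (w k) (w k) = (1 / 2) * (spinFlip v₀ v₀ + ω ^ 2 * spinFlip v₁ v₁) := by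
      rw [← ofReal_inv_sqrt_two_mul_self]
      unfold spinFlip at hS
      fin_cases k <;> simp [hw_def, balancedPair, spinFlip]
      · linear_combination 2 * ω * (√2 : ℂ)⁻¹ * (√2 : ℂ)⁻¹ * hS
      · linear_combination -2 * ω * (√2 : ℂ)⁻¹ * (√2 : ℂ)⁻¹ * hS
    rw [pureConcurrence_eq, this, norm_mul, hω2]
    norm_num
  simp only [hw, Fin.sum_univ_two] at he
  have : Nonempty (Realization ρ) := ⟨e⟩
  refine le_antisymm ?_ (le_ciInf fun e => e.le_average_pureConcurrence hS hρ)
  refine (e.convexRoof_le_average continuous_pureConcurrence).trans (he.trans ?_).le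
  ring

end RankTwo

/-! ### The 3-tangle from concurrences. -/

/-- On three qubits `√(C_a² - C²)` is the usual 3-tangle. -/
theorem pureTau3Gen_eq_pureTau3 {ψ : EuclideanSpace ℂ (Fin 2 × Fin 2 × Fin 2)} (hψ : ‖ψ‖ = 1) :
    pureTau3Gen ψ = pureTau3 ψ := by
  set u := slice ψ 0 with hu
  set v := slice ψ 1 with hv
  obtain ⟨c, s, l, hcs, h1, h2⟩ :=
    exists_coneigenvector (spinFlip u u) (spinFlip u v) (spinFlip v v)
  have hcs' : c * star c + s * star s = 1 := by
    rw [RCLike.star_def, Complex.mul_conj', Complex.mul_conj']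
    exact_mod_cast hcs
  -- `y` completes `x` to a unitary recombination; the coneigenvector equations give `S(x,y) = l
  -- (-s̄ c̄ + c̄ s̄) = 0`.
  let x := c • u + s • v
  let y := (-star s) • u + star c • v
  have hxx : spinFlip x x = c ^ 2 * spinFlip u u + 2 * c * s * spinFlip u v
      + s ^ 2 * spinFlip v v := by
    simp [x, spinFlip]; ring
  have hyy : spinFlip y y = star s ^ 2 * spinFlip u u - 2 * star c * star s * spinFlip u v
      + star c ^ 2 * spinFlip v v := by
    simp [y, spinFlip]; ring
  have hxy : spinFlip x y = 0 := by
    have : spinFlip x y = -star s * (spinFlip u u * c + spinFlip u v * s)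
        + star c * (spinFlip u v * c + spinFlip v v * s) := by
      simp [x, y, spinFlip]; ring
    rw [this, h1, h2]
    ring
  have hρ : ketBra x + ketBra y = trFst (ketBra ψ) := by
    rw [← trFst_ketBra, Fin.sum_univ_two, ← hu, ← hv]
    ext i j
    simp [x, y, ketBra]
    simp at hcs'
    linear_combination (u i * (starRingEnd ℂ) (u j) + v i * (starRingEnd ℂ) (v j)) * hcs'
  have hn : ‖x‖ ^ 2 + ‖y‖ ^ 2 = 1 := by
    have h := congrArg Matrix.trace hρ
    rw [← trFst_ketBra, Matrix.trace_add, Matrix.trace_sum] at h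
    simp only [trace_ketBra] at h
    have hs := sum_norm_slice_sq ψ
    rw [hψ, one_pow] at hs
    rw [← hs]
    exact_mod_cast h
  -- The Gram determinant of `S` is multiplied by the square of the determinant `c c̄ + s s̄ = 1` of
  -- the recombination.
  have hdet : spinFlip u u * spinFlip v v - spinFlip u v ^ 2 = spinFlip x x * spinFlip y y := by
    have hE : -star s * (spinFlip u u * c + spinFlip u v * s)
        + star c * (spinFlip u v * c + spinFlip v v * s) = 0 := by
      rw [h1, h2]
      ring
    rw [hxx, hyy]
    linear_combination (-(spinFlip u u * spinFlip v v - spinFlip u v ^ 2)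
      * (c * star c + s * star s + 1)) * hcs' - (-star s * (spinFlip u u * c + spinFlip u v * s)
        + star c * (spinFlip u v * c + spinFlip v v * s)) * hE
  rw [pureTau3Gen, pureTau3, mu3_eq, ← hu, ← hv, hdet, norm_mul,
    concurrenceOfAssistance_eq hxy hρ hn, concurrence_eq hxy hρ hn, sq_abs]
  congr 1
  ring

/-! ### The monogamy inequality. -/

/-- The reverse Minkowski inequality for the function `√(a² - c²)`. -/
theorem sum_mul_sqrt_sq_sub_sq_le {κ : Type*} [Fintype κ] {p a c : κ → ℝ} (hp : ∀ i, 0 ≤ p i)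
    (hc : ∀ i, 0 ≤ c i) (hac : ∀ i, c i ≤ a i) :
    (∑ i, p i * √(a i ^ 2 - c i ^ 2)) ^ 2 ≤ (∑ i, p i * a i) ^ 2 - (∑ i, p i * c i) ^ 2 := by
  have h := Finset.sum_sq_le_sum_mul_sum_of_sq_le_mul Finset.univ
    (r := fun i => p i * √(a i ^ 2 - c i ^ 2)) (f := fun i => p i * (a i - c i))
    (g := fun i => p i * (a i + c i))
    (fun i _ => mul_nonneg (hp i) (by linarith [hac i]))
    (fun i _ => mul_nonneg (hp i) (by linarith [hac i, hc i]))
    (fun i _ => le_of_eq (by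
      rw [mul_pow, Real.sq_sqrt (by nlinarith [hac i, hc i])]
      ring))
  simp only [mul_sub, mul_add, Finset.sum_sub_distrib, Finset.sum_add_distrib] at h
  linarith

section ReducedStates

variable {ι : Type*} [Fintype ι] {ψ : EuclideanSpace ℂ (ι × Fin 2 × Fin 2)}

theorem concurrence_le_concurrenceOfAssistance
    (ρ : Matrix (Fin 2 × Fin 2) (Fin 2 × Fin 2) ℂ) [Nonempty (Realization ρ)] :
    concurrence ρ ≤ concurrenceOfAssistance ρ :=
  convexRoof_le_assistance continuous_pureConcurrence

theorem concurrence_nonneg (ρ : Matrix (Fin 2 × Fin 2) (Fin 2 × Fin 2) ℂ) : 0 ≤ concurrence ρ :=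
  convexRoof_nonneg pureConcurrence_nonneg

theorem pureTau3Gen_sq (hψ : ‖ψ‖ = 1) :
    pureTau3Gen ψ ^ 2 = concurrenceOfAssistance (trFst (ketBra ψ)) ^ 2
      - concurrence (trFst (ketBra ψ)) ^ 2 := by
  have := nonempty_realization_trFst hψ
  refine Real.sq_sqrt (sub_nonneg.2 ?_)
  exact pow_le_pow_left₀ (concurrence_nonneg _) (concurrence_le_concurrenceOfAssistance _) 2

end ReducedStates

section FourQubits

variable {φ : EuclideanSpace ℂ (Fin 2 × Fin 2 × Fin 2 × Fin 2)}

theorem trFst_ketBra_groupAB (φ : EuclideanSpace ℂ (Fin 2 × Fin 2 × Fin 2 × Fin 2)) :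
    trFst (ketBra (groupAB φ)) = trFst (trFst (ketBra φ)) := by
  ext i j
  simp only [trFst, ketBra, groupAB, Matrix.of_apply, Fintype.sum_prod_type]
  exact Finset.sum_comm

theorem norm_groupAB (φ : EuclideanSpace ℂ (Fin 2 × Fin 2 × Fin 2 × Fin 2)) :
    ‖groupAB φ‖ = ‖φ‖ := by
  simp only [EuclideanSpace.norm_eq, groupAB, Fintype.sum_prod_type]

theorem pureTau3Gen_groupAB_sq (hφ : ‖φ‖ = 1) :
    pureTau3Gen (groupAB φ) ^ 2 = concurrenceOfAssistance (trFst (trFst (ketBra φ))) ^ 2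
      - concurrence (trFst (trFst (ketBra φ))) ^ 2 := by
  rw [pureTau3Gen_sq (by rwa [norm_groupAB]), trFst_ketBra_groupAB]

theorem tauTraceA_sq_add (hφ : ‖φ‖ = 1) :
    tauTraceA φ ^ 2 + tau3 (trFst (ketBra φ)) ^ 2 = tauA (trFst (ketBra φ)) ^ 2 := by
  have := nonempty_realization_trFst hφ
  have h : tau3 (trFst (ketBra φ)) ^ 2 ≤ tauA (trFst (ketBra φ)) ^ 2 :=
    pow_le_pow_left₀ (convexRoof_nonneg pureTau3_nonneg)
      (convexRoof_le_assistance continuous_pureTau3) 2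
  rw [tauTraceA, tau4, Real.sq_sqrt (sub_nonneg.2 h), sub_add_cancel]

theorem Realization.average_pureTau3 {ρ : Matrix (Fin 2 × Fin 2 × Fin 2) (Fin 2 × Fin 2 × Fin 2) ℂ}
    (e : Realization ρ) :
    e.average pureTau3 = ∑ i, e.p i * √(concurrenceOfAssistance (trFst (ketBra (e.vec i))) ^ 2
      - concurrence (trFst (ketBra (e.vec i))) ^ 2) :=
  Finset.sum_congr rfl fun i _ => by rw [← pureTau3Gen_eq_pureTau3 (e.vec_norm i), pureTau3Gen]

/-- Optimality plays no role here: the bound holds for every realization, and an optimal one is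
inserted afterwards. -/
theorem Realization.average_pureTau3_sq_le
    {ρ : Matrix (Fin 2 × Fin 2 × Fin 2) (Fin 2 × Fin 2 × Fin 2) ℂ} (e : Realization ρ) :
    e.average pureTau3 ^ 2 ≤ concurrenceOfAssistance (trFst ρ) ^ 2 - concurrence (trFst ρ) ^ 2 := by
  have := fun i => nonempty_realization_trFst (e.vec_norm i)
  have hρ : ∑ i, (e.p i : ℂ) • trFst (ketBra (e.vec i)) = trFst ρ := by
    rw [← trFst_sum_smul, e.mixture]
  have ha := le_assistance_mixture continuous_pureConcurrence e.p_nonneg e.p_sum hρ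
  have hc := convexRoof_mixture_le continuous_pureConcurrence e.p_nonneg e.p_sum hρ
  rw [e.average_pureTau3]
  refine (sum_mul_sqrt_sq_sub_sq_le e.p_nonneg (fun i => concurrence_nonneg _)
    fun i => concurrence_le_concurrenceOfAssistance _).trans (sub_le_sub ?_ ?_)
  · refine pow_le_pow_left₀ (Finset.sum_nonneg fun i _ => mul_nonneg (e.p_nonneg i) ?_) ha 2
    exact (concurrence_nonneg _).trans (concurrence_le_concurrenceOfAssistance _)
  · exact pow_le_pow_left₀ (concurrence_nonneg _) hc 2

theorem exists_optimal_realization (hφ : ‖φ‖ = 1) :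
    ∃ e : Realization (trFst (ketBra φ)), e.average pureTau3 = tauA (trFst (ketBra φ)) :=
  have := nonempty_realization_trFst hφ
  exists_average_eq_assistance continuous_pureTau3

theorem monogamy (hφ : ‖φ‖ = 1) :
    tauTraceA φ ^ 2 + tau3 (trFst (ketBra φ)) ^ 2 ≤ pureTau3Gen (groupAB φ) ^ 2 := by
  obtain ⟨e, he⟩ := exists_optimal_realization hφ
  rw [tauTraceA_sq_add hφ, pureTau3Gen_groupAB_sq hφ, ← he]
  exact e.average_pureTau3_sq_le

end FourQubits

/-! ### Saturation by the GHZ state. -/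

section GHZ

theorem pureConcurrence_le_norm_sq (x : EuclideanSpace ℂ (Fin 2 × Fin 2)) :
    pureConcurrence x ≤ ‖x‖ ^ 2 := by
  have h := norm_sub_le (x (0, 0) * x (1, 1)) (x (0, 1) * x (1, 0))
  rw [norm_mul, norm_mul] at h
  rw [EuclideanSpace.norm_sq_eq, pureConcurrence]
  simp only [Fintype.sum_prod_type, Fin.sum_univ_two]
  nlinarith [sq_nonneg (‖x (0, 0)‖ - ‖x (1, 1)‖), sq_nonneg (‖x (0, 1)‖ - ‖x (1, 0)‖)]

theorem concurrenceOfAssistance_le_one (ρ : Matrix (Fin 2 × Fin 2) (Fin 2 × Fin 2) ℂ) :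
    concurrenceOfAssistance ρ ≤ 1 := by
  refine Real.iSup_le (fun e => ?_) zero_le_one
  refine (Finset.sum_le_sum fun i _ => ?_).trans e.p_sum.le
  refine mul_le_of_le_one_right (e.p_nonneg i) ?_
  simpa [e.vec_norm] using pureConcurrence_le_norm_sq (e.vec i)

theorem norm_ghz4 : ‖ghz4‖ = 1 := by
  rw [← sq_eq_sq₀ (norm_nonneg _) zero_le_one, EuclideanSpace.norm_sq_eq]
  simp [Fintype.sum_prod_type, Fin.sum_univ_two, ghz4]
  norm_num

theorem one_le_tauA_ghz4 : 1 ≤ tauA (trFst (ketBra ghz4)) := by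
  -- These are `(|000⟩ ± |111⟩)/2`: two GHZ states of weight `1/2`, each of 3-tangle `1` once
  -- normalized.
  set w := balancedPair (slice ghz4 0) (slice ghz4 1) with hw
  have hρ : ∑ k, ketBra (w k) = trFst (ketBra ghz4) := by
    rw [sum_ketBra_balancedPair, ← trFst_ketBra, Fin.sum_univ_two]
  have hn : ∑ k, ‖w k‖ ^ 2 = 1 := by
    rw [sum_norm_sq_balancedPair, ← Fin.sum_univ_two fun a => ‖slice ghz4 a‖ ^ 2,
      sum_norm_slice_sq, norm_ghz4, one_pow]
  have ht : ∀ k, pureTau3 (w k) = 1 / 2 := by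
    intro k
    have : mu3 (w k) = (1 / 2) ^ 2 := by
      have h : |√2|⁻¹ * |√2|⁻¹ = 1 / 2 := by
        rw [← mul_inv, abs_mul_abs_self, Real.mul_self_sqrt zero_le_two, one_div]
      fin_cases k <;> simp [hw, balancedPair, mu3, slice, ghz4, ← mul_pow, h] <;> norm_num
    rw [pureTau3, this, Real.sqrt_sq (by norm_num)]
  obtain ⟨e, he⟩ := exists_realization_of_sum_norm_sq w hn hρ pureTau3_smul
  refine le_trans (le_of_eq ?_) (e.average_le_assistance continuous_pureTau3)
  rw [he, Fin.sum_univ_two, ht, ht]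
  norm_num

theorem monogamy_ghz4 :
    tauTraceA ghz4 ^ 2 + tau3 (trFst (ketBra ghz4)) ^ 2 = pureTau3Gen (groupAB ghz4) ^ 2 := by
  refine le_antisymm (monogamy norm_ghz4) ?_
  rw [tauTraceA_sq_add norm_ghz4, pureTau3Gen_groupAB_sq norm_ghz4]
  have := nonempty_realization_trFst (ψ := groupAB ghz4) (by rw [norm_groupAB, norm_ghz4])
  rw [trFst_ketBra_groupAB] at this
  have h0 := (concurrence_nonneg (trFst (trFst (ketBra ghz4)))).trans
    (concurrence_le_concurrenceOfAssistance _)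
  -- `C_a² - C² ≤ 1 ≤ τ_a²` gives the reverse inequality.
  nlinarith [one_le_tauA_ghz4, concurrenceOfAssistance_le_one (trFst (trFst (ketBra ghz4))),
    sq_nonneg (concurrence (trFst (trFst (ketBra ghz4))))]

end GHZ

end QEnt

theorem mainTheorem2 :
    -- on three qubits the extended 3-tangle is the usual one
    (∀ ψ : EuclideanSpace ℂ (Fin 2 × Fin 2 × Fin 2), ‖ψ‖ = 1 →
      QEnt.pureTau3Gen ψ = QEnt.pureTau3 ψ) ∧
    (∀ φ : EuclideanSpace ℂ (Fin 2 × Fin 2 × Fin 2 × Fin 2), ‖φ‖ = 1 →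
      -- an optimal realization of `ρ_BCD` exists
      (∃ e : QEnt.Realization (QEnt.trFst (QEnt.ketBra φ)),
        e.average QEnt.pureTau3 = QEnt.tauA (QEnt.trFst (QEnt.ketBra φ))) ∧
      -- for every optimal realization, the first equality of the chain
      (∀ e : QEnt.Realization (QEnt.trFst (QEnt.ketBra φ)),
        e.average QEnt.pureTau3 = QEnt.tauA (QEnt.trFst (QEnt.ketBra φ)) →
        QEnt.tauTraceA φ ^ 2 + QEnt.tau3 (QEnt.trFst (QEnt.ketBra φ)) ^ 2
          = (∑ i, e.p i *
              √(QEnt.concurrenceOfAssistance (QEnt.trFst (QEnt.ketBra (e.vec i))) ^ 2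
                - QEnt.concurrence (QEnt.trFst (QEnt.ketBra (e.vec i))) ^ 2)) ^ 2) ∧
      -- the monogamy inequality
      QEnt.tauTraceA φ ^ 2 + QEnt.tau3 (QEnt.trFst (QEnt.ketBra φ)) ^ 2
        ≤ QEnt.pureTau3Gen (QEnt.groupAB φ) ^ 2 ∧
      -- the value of the right-hand side, with `ρ_CD = Tr_B ρ_BCD`
      QEnt.pureTau3Gen (QEnt.groupAB φ) ^ 2
        = QEnt.concurrenceOfAssistance (QEnt.trFst (QEnt.trFst (QEnt.ketBra φ))) ^ 2
          - QEnt.concurrence (QEnt.trFst (QEnt.trFst (QEnt.ketBra φ))) ^ 2) ∧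
    -- saturation by the GHZ state
    ‖QEnt.ghz4‖ = 1 ∧
    QEnt.tauTraceA QEnt.ghz4 ^ 2 + QEnt.tau3 (QEnt.trFst (QEnt.ketBra QEnt.ghz4)) ^ 2
      = QEnt.pureTau3Gen (QEnt.groupAB QEnt.ghz4) ^ 2 :=

  ⟨fun _ hψ => QEnt.pureTau3Gen_eq_pureTau3 hψ,
    fun _ hφ => ⟨QEnt.exists_optimal_realization hφ,
      fun e he => by rw [QEnt.tauTraceA_sq_add hφ, ← he, e.average_pureTau3],
      QEnt.monogamy hφ, QEnt.pureTau3Gen_groupAB_sq hφ⟩,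
    QEnt.norm_ghz4, QEnt.monogamy_ghz4⟩
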